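/- Let $M$ be a smooth manifold of odd dimension $2m+1$ with an almost contact metric structure $(\xi,\eta,\varphi,g)$, i.e. a smooth vector field $\xi$, a smooth $1$-form $\eta$, a smooth $(1,1)$-tensor field $\varphi$ and a smooth (pseudo-)Riemannian metric $g$ such that $$\varphi^2=-I+\eta\otimes\xi,\qquad \eta(\xi)=1,\qquad g(\varphi X,\varphi Y)=g(X,Y)-\eta(X)\eta(Y).$$ Let $\Omega(X,Y)=g(X,\varphi Y)$ be the fundamental form, let $d\eta$ be normalized by $2\,d\eta(X,Y)=X\eta(Y)-Y\eta(X)-\eta([X,Y])$, let $N_\varphi(X,Y)=[\varphi X,\varphi Y]+\varphi^2[X,Y]-\varphi[\varphi X,Y]-\varphi[X,\varphi Y]$, and let $\psi$ be the endomorphism field determined by $d\eta(X,Y)=g(\psi X,Y)$. Let $\widetilde\nabla$ be the Levi-Civita connection of $g$. The structure is called quasi-Sasakian if it is normal, $N_\varphi+2\,d\eta\otimes\xi=0$, and $d\Omega=0$. Then the structure is quasi-Sasakian if and only if $$(\widetilde\nabla_X\varphi)Y=g(AY,X)\,\xi-\eta(Y)AX,\qquad A=\varphi\circ\psi,$$ for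 all smooth vector fields $X,Y$ on $M$. -/

import Mathlib

open Bundle VectorField
open scoped Manifold ContDiff

set_option linter.unusedSectionVars false

noncomputable section

section General

variable {E : Type*} [NormedAddCommGroup E] [NormedSpace ℝ E]
  {H : Type*} [TopologicalSpace H] (I : ModelWithCorners ℝ E H)
  (M : Type*) [TopologicalSpace M] [ChartedSpace H M]

/-- A smooth pseudo-Riemannian metric on `M`: a smooth, symmetric, nondegenerate `(0,2)`-tensor
field. (A Riemannian metric is the positive definite case.) -/
structure PseudoRiemannianMetric [IsManifold I ∞ M] where
  /-- the bilinear form on each tangent space -/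
  val (x : M) : TangentSpace I x →L[ℝ] TangentSpace I x →L[ℝ] ℝ
  symm (x : M) (v w : TangentSpace I x) : val x v w = val x w v
  nondeg (x : M) (v : TangentSpace I x) (hv : ∀ w, val x v w = 0) : v = 0
  contMDiff : ContMDiff I (I.prod 𝓘(ℝ, E →L[ℝ] E →L[ℝ] ℝ)) ∞
    (fun x ↦ TotalSpace.mk' (E →L[ℝ] E →L[ℝ] ℝ) x (val x))

variable {M}

/-- The vector field `X` on `M` is smooth (of class `C^∞`) on all of `M`. -/
def IsSmoothVectorField [IsManifold I ∞ M] (X : Π x : M, TangentSpace I x) : Prop :=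
  ContMDiff I I.tangent ∞ (fun x ↦ (⟨x, X x⟩ : TangentBundle I M))

variable {I} [IsManifold I ∞ M]

theorem mdifferentiableAt_bilin {B : Π x : M, TangentSpace I x →L[ℝ] TangentSpace I x →L[ℝ] ℝ}
    (hB : ContMDiff I (I.prod 𝓘(ℝ, E →L[ℝ] E →L[ℝ] ℝ)) ∞
      (fun x ↦ TotalSpace.mk' (E →L[ℝ] E →L[ℝ] ℝ) x (B x)))
    {X Y : Π x : M, TangentSpace I x} {x : M}
    (hX : MDiffAt (T% X) x) (hY : MDiffAt (T% Y) x) :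
    MDiffAt (fun y ↦ B y (X y) (Y y)) x := by
  have : MDifferentiableAt I (I.prod 𝓘(ℝ))
      (fun m ↦ TotalSpace.mk' ℝ (E := Bundle.Trivial M ℝ) m (B m (X m) (Y m))) x := by
    apply MDifferentiableAt.clm_bundle_apply₂ (F₁ := E) (F₂ := E)
    · exact hB.mdifferentiable (by simp) x
    · exact hX
    · exact hY
  simp only [mdifferentiableAt_totalSpace] at this
  exact this.2

theorem mdifferentiableAt_oneForm {η : Π x : M, TangentSpace I x →L[ℝ] ℝ}
    (hη : ContMDiff I (I.prod 𝓘(ℝ, E →L[ℝ] ℝ)) ∞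
      (fun x ↦ TotalSpace.mk' (E →L[ℝ] ℝ) x (η x)))
    {X : Π x : M, TangentSpace I x} {x : M} (hX : MDiffAt (T% X) x) :
    MDiffAt (fun y ↦ η y (X y)) x := by
  have : MDifferentiableAt I (I.prod 𝓘(ℝ))
      (fun m ↦ TotalSpace.mk' ℝ (E := Bundle.Trivial M ℝ) m (η m (X m))) x := by
    apply MDifferentiableAt.clm_bundle_apply (F₁ := E)
    · exact hη.mdifferentiable (by simp) x
    · exact hX
  simp only [mdifferentiableAt_totalSpace] at this
  exact this.2

namespace PseudoRiemannianMetric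

variable (g : PseudoRiemannianMetric I M)

/-- `g(X,Y)` as a function on `M`. -/
def pair (X Y : Π x : M, TangentSpace I x) : M → ℝ := fun x ↦ g.val x (X x) (Y x)

theorem mdifferentiableAt_pair {X Y : Π x : M, TangentSpace I x} {x : M}
    (hX : MDiffAt (T% X) x) (hY : MDiffAt (T% Y) x) : MDiffAt (g.pair X Y) x :=
  mdifferentiableAt_bilin g.contMDiff hX hY

/-- The right-hand side of the Koszul formula: `2 g(∇_X Y, Z)` equals
`X g(Y,Z) + Y g(Z,X) - Z g(X,Y) + g([X,Y],Z) - g([Y,Z],X) + g([Z,X],Y)`. -/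
def koszul (Y X Z : Π x : M, TangentSpace I x) (x : M) : ℝ :=
  mvfderiv I (g.pair Y Z) x (X x) + mvfderiv I (g.pair Z X) x (Y x)
    - mvfderiv I (g.pair X Y) x (Z x)
    + g.val x (mlieBracket I X Y x) (Z x) - g.val x (mlieBracket I Y Z x) (X x)
    + g.val x (mlieBracket I Z X x) (Y x)

theorem pair_smul_left (f : M → ℝ) (X Y : Π x : M, TangentSpace I x) :
    g.pair (f • X) Y = f * g.pair X Y := by
  ext x; simp [pair]

theorem pair_smul_right (f : M → ℝ) (X Y : Π x : M, TangentSpace I x) :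
    g.pair X (f • Y) = f * g.pair X Y := by
  ext x; simp [pair]

theorem pair_add_left (X X' Y : Π x : M, TangentSpace I x) :
    g.pair (X + X') Y = g.pair X Y + g.pair X' Y := by
  ext x; simp [pair]

theorem pair_add_right (X Y Y' : Π x : M, TangentSpace I x) :
    g.pair X (Y + Y') = g.pair X Y + g.pair X Y' := by
  ext x; simp [pair]

/-- `g` at `x` as a bilinear form. -/
def bilinForm (x : M) : LinearMap.BilinForm ℝ (TangentSpace I x) :=
  LinearMap.mk₂ ℝ (fun v w ↦ g.val x v w) (by simp) (by simp) (by simp) (by simp)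

theorem bilinForm_nondegenerate (x : M) : (g.bilinForm x).Nondegenerate := by
  refine ⟨fun v hv ↦ g.nondeg x v fun w ↦ hv w, fun v hv ↦ g.nondeg x v fun w ↦ ?_⟩
  rw [g.symm]
  exact hv w

theorem ext_val {x : M} {v w : TangentSpace I x} (h : ∀ z, g.val x v z = g.val x w z) : v = w :=
  sub_eq_zero.1 (g.nondeg x _ fun z ↦ by simp [h z])

variable [CompleteSpace E]

theorem koszul_tensorial_left {Y Z : Π x : M, TangentSpace I x} {x : M}
    (hY : MDiffAt (T% Y) x) (hZ : MDiffAt (T% Z) x) :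
    TensorialAt I E (fun X ↦ g.koszul Y X Z x) x where
  smul {f X} hf hX := by
    simp only [koszul, pair_smul_left, pair_smul_right,
      mvfderiv_mul hf (g.mdifferentiableAt_pair hZ hX),
      mvfderiv_mul hf (g.mdifferentiableAt_pair hX hY),
      mlieBracket_smul_left hf hX, mlieBracket_smul_right hf hX]
    simp [pair, g.symm x (Z x)]
    ring
  add {X X'} hX hX' := by
    simp only [koszul, pair_add_left, pair_add_right,
      mvfderiv_add (g.mdifferentiableAt_pair hZ hX) (g.mdifferentiableAt_pair hZ hX'),
      mvfderiv_add (g.mdifferentiableAt_pair hX hY) (g.mdifferentiableAt_pair hX' hY),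
      mlieBracket_add_left hX hX', mlieBracket_add_right hX hX']
    simp
    ring

theorem koszul_tensorial_right {Y X : Π x : M, TangentSpace I x} {x : M}
    (hY : MDiffAt (T% Y) x) (hX : MDiffAt (T% X) x) :
    TensorialAt I E (fun Z ↦ g.koszul Y X Z x) x where
  smul {f Z} hf hZ := by
    simp only [koszul, pair_smul_left, pair_smul_right,
      mvfderiv_mul hf (g.mdifferentiableAt_pair hZ hX),
      mvfderiv_mul hf (g.mdifferentiableAt_pair hY hZ),
      mlieBracket_smul_left hf hZ, mlieBracket_smul_right hf hZ]
    simp [pair, g.symm x (Z x)]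
    rw [g.symm x (Y x) (Z x)]
    ring
  add {Z Z'} hZ hZ' := by
    simp only [koszul, pair_add_left, pair_add_right,
      mvfderiv_add (g.mdifferentiableAt_pair hZ hX) (g.mdifferentiableAt_pair hZ' hX),
      mvfderiv_add (g.mdifferentiableAt_pair hY hZ) (g.mdifferentiableAt_pair hY hZ'),
      mlieBracket_add_left hZ hZ', mlieBracket_add_right hZ hZ']
    simp
    ring

variable [FiniteDimensional ℝ E]

instance finiteDimensional_tangentSpace (x : M) : FiniteDimensional ℝ (TangentSpace I x) :=
  inferInstanceAs (FiniteDimensional ℝ E)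

instance t2Space_tangentSpace (x : M) : T2Space (TangentSpace I x) :=
  inferInstanceAs (T2Space E)

/-- Raising an index: `g.sharp x α` is the vector `v` with `g(v, w) = α(w)` for all `w`. -/
def sharp (x : M) : (TangentSpace I x →L[ℝ] ℝ) →ₗ[ℝ] TangentSpace I x :=
  ((g.bilinForm x).toDual (g.bilinForm_nondegenerate x)).symm.toLinearMap ∘ₗ
    ContinuousLinearMap.coeLM ℝ

theorem val_sharp (x : M) (α : TangentSpace I x →L[ℝ] ℝ) (w : TangentSpace I x) :
    g.val x (g.sharp x α) w = α w :=
  LinearMap.BilinForm.apply_toDual_symm_apply (hB := g.bilinForm_nondegenerate x) (α : _ →ₗ[ℝ] ℝ) w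

open Classical in
/-- The operator `Y ↦ (X ↦ ∇_X Y)` given by the Koszul formula. The value on fields that are not
differentiable at the point is irrelevant. -/
def leviCivitaFun (Y : Π x : M, TangentSpace I x) (x : M) :
    TangentSpace I x →L[ℝ] TangentSpace I x :=
  if hY : MDiffAt (T% Y) x then
    LinearMap.toContinuousLinearMap ((1 / 2 : ℝ) • (g.sharp x ∘ₗ
      (TensorialAt.mkHom₂ (I := I) (F := E) (F' := E) (fun X Z ↦ g.koszul Y X Z x) x
        (fun _ hZ ↦ g.koszul_tensorial_left hY hZ)
        (fun _ hX ↦ g.koszul_tensorial_right hY hX)).toLinearMap))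
  else 0

theorem two_mul_val_leviCivitaFun {X Y Z : Π x : M, TangentSpace I x} {x : M}
    (hX : MDiffAt (T% X) x) (hY : MDiffAt (T% Y) x) (hZ : MDiffAt (T% Z) x) :
    2 * g.val x (g.leviCivitaFun Y x (X x)) (Z x) = g.koszul Y X Z x := by
  have h := TensorialAt.mkHom₂_apply (I := I) (F := E) (F' := E)
    (Φ := fun X Z ↦ g.koszul Y X Z x)
    (fun _ hZ ↦ g.koszul_tensorial_left hY hZ) (fun _ hX ↦ g.koszul_tensorial_right hY hX) hX hZ
  simp only [leviCivitaFun, hY, dif_pos]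
  simp [g.val_sharp, h]

/-- The Levi-Civita connection of `g`. -/
def leviCivita : CovariantDerivative I E (TangentSpace I : M → Type _) where
  toFun := g.leviCivitaFun
  isCovariantDerivativeOnUniv :=
    { add := by
        intro Y Y' x hY hY' _
        ext v
        refine g.ext_val fun z ↦ ?_
        obtain ⟨X, hX, rfl⟩ : ∃ X : Π x : M, TangentSpace I x, MDiffAt (T% X) x ∧ X x = v :=
          ⟨_, FiberBundle.mdifferentiableAt_extend I E v, by simp⟩
        obtain ⟨Z, hZ, rfl⟩ : ∃ X : Π x : M, TangentSpace I x, MDiffAt (T% X) x ∧ X x = z :=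
          ⟨_, FiberBundle.mdifferentiableAt_extend I E z, by simp⟩
        have h1 := g.two_mul_val_leviCivitaFun hX hY hZ
        have h2 := g.two_mul_val_leviCivitaFun hX hY' hZ
        have h3 := g.two_mul_val_leviCivitaFun hX (mdifferentiableAt_add_section hY hY') hZ
        simp only [koszul, pair_add_left, pair_add_right,
          mvfderiv_add (g.mdifferentiableAt_pair hY hZ) (g.mdifferentiableAt_pair hY' hZ),
          mvfderiv_add (g.mdifferentiableAt_pair hX hY) (g.mdifferentiableAt_pair hX hY'),
          mlieBracket_add_left hY hY', mlieBracket_add_right hY hY', Pi.add_apply, map_add,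
          add_apply] at h1 h2 h3 ⊢
        linarith
      leibniz := by
        intro Y f x hY hf _
        ext v
        refine g.ext_val fun z ↦ ?_
        obtain ⟨X, hX, rfl⟩ : ∃ X : Π x : M, TangentSpace I x, MDiffAt (T% X) x ∧ X x = v :=
          ⟨_, FiberBundle.mdifferentiableAt_extend I E v, by simp⟩
        obtain ⟨Z, hZ, rfl⟩ : ∃ X : Π x : M, TangentSpace I x, MDiffAt (T% X) x ∧ X x = z :=
          ⟨_, FiberBundle.mdifferentiableAt_extend I E z, by simp⟩
        have h1 := g.two_mul_val_leviCivitaFun hX hY hZ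
        have h2 := g.two_mul_val_leviCivitaFun hX (hf.smul_section hY) hZ
        have h3 : g.val x (X x) (Y x) = g.val x (Y x) (X x) := g.symm _ _ _
        simp only [koszul, pair_smul_left, pair_smul_right,
          mvfderiv_mul hf (g.mdifferentiableAt_pair hY hZ),
          mvfderiv_mul hf (g.mdifferentiableAt_pair hX hY),
          mlieBracket_smul_left hf hY, mlieBracket_smul_right hf hY] at h1 h2 ⊢
        simp [pair] at h1 h2 ⊢
        linear_combination h2 / 2 - f x * h1 / 2 - (mvfderiv I f x (Z x)) * h3 / 2 }

theorem two_mul_val_leviCivita {X Y Z : Π x : M, TangentSpace I x} {x : M}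
    (hX : MDiffAt (T% X) x) (hY : MDiffAt (T% Y) x) (hZ : MDiffAt (T% Z) x) :
    2 * g.val x (g.leviCivita Y x (X x)) (Z x) = g.koszul Y X Z x :=
  g.two_mul_val_leviCivitaFun hX hY hZ

/-- The Levi-Civita connection is torsion-free. -/
theorem leviCivita_torsion : g.leviCivita.torsion = 0 := by
  rw [CovariantDerivative.torsion_eq_zero_iff]
  intro X Y x hX hY
  refine g.ext_val fun z ↦ ?_
  obtain ⟨Z, hZ, rfl⟩ : ∃ X : Π x : M, TangentSpace I x, MDiffAt (T% X) x ∧ X x = z :=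
    ⟨_, FiberBundle.mdifferentiableAt_extend I E z, by simp⟩
  have h1 := g.two_mul_val_leviCivita hX hY hZ
  have h2 := g.two_mul_val_leviCivita hY hX hZ
  have e (U V : Π x : M, TangentSpace I x) : g.pair U V = g.pair V U := by
    ext y; exact g.symm _ _ _
  rw [koszul, e Y Z, e Z X, mlieBracket_swap_apply (V := Y) (W := Z)] at h1
  rw [koszul, e Y X, mlieBracket_swap_apply (V := Y) (W := X),
    mlieBracket_swap_apply (V := X) (W := Z)] at h2
  simp only [map_neg, map_sub, neg_apply, sub_apply]
    at h1 h2 ⊢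
  linarith

/-- The Levi-Civita connection is compatible with `g`. -/
theorem leviCivita_metric {X Y Z : Π x : M, TangentSpace I x} {x : M}
    (hX : MDiffAt (T% X) x) (hY : MDiffAt (T% Y) x) (hZ : MDiffAt (T% Z) x) :
    mvfderiv I (g.pair Y Z) x (X x) =
      g.val x (g.leviCivita Y x (X x)) (Z x) + g.val x (Y x) (g.leviCivita Z x (X x)) := by
  have h1 := g.two_mul_val_leviCivita hX hY hZ
  have h2 := g.two_mul_val_leviCivita hX hZ hY
  have e (U V : Π x : M, TangentSpace I x) : g.pair U V = g.pair V U := by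
    ext y; exact g.symm _ _ _
  rw [g.symm x (Y x)]
  rw [koszul, e Z X, mlieBracket_swap_apply (V := Z) (W := X)] at h1
  rw [koszul, e Y X, e Z Y, mlieBracket_swap_apply (V := Z) (W := Y),
    mlieBracket_swap_apply (V := Y) (W := X)] at h2
  simp only [map_neg, neg_apply] at h1 h2
  linarith

end PseudoRiemannianMetric

/-- The exterior derivative of a `1`-form evaluated on vector fields, with the normalization
`2 dη(X,Y) = X η(Y) - Y η(X) - η([X,Y])`. -/
def extDerivOneFun (η : Π x : M, TangentSpace I x →L[ℝ] ℝ) (X Y : Π x : M, TangentSpace I x)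
    (x : M) : ℝ :=
  (1 / 2) * (mvfderiv I (fun y ↦ η y (Y y)) x (X x) - mvfderiv I (fun y ↦ η y (X y)) x (Y x)
    - η x (mlieBracket I X Y x))

/-- The exterior derivative of a `2`-form evaluated on vector fields, with the normalization
`3 dΩ(X,Y,Z) = X Ω(Y,Z) + Y Ω(Z,X) + Z Ω(X,Y) - Ω([X,Y],Z) - Ω([Y,Z],X) - Ω([Z,X],Y)`. -/
def extDerivTwoFun (Ω : Π x : M, LinearMap.BilinForm ℝ (TangentSpace I x))
    (X Y Z : Π x : M, TangentSpace I x) (x : M) : ℝ :=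
  (1 / 3) * (mvfderiv I (fun y ↦ Ω y (Y y) (Z y)) x (X x)
    + mvfderiv I (fun y ↦ Ω y (Z y) (X y)) x (Y x)
    + mvfderiv I (fun y ↦ Ω y (X y) (Y y)) x (Z x)
    - Ω x (mlieBracket I X Y x) (Z x) - Ω x (mlieBracket I Y Z x) (X x)
    - Ω x (mlieBracket I Z X x) (Y x))

/-- The Nijenhuis torsion
`N_φ(X,Y) = [φX,φY] + φ²[X,Y] - φ[φX,Y] - φ[X,φY]` of an endomorphism field `φ`. -/
def nijenhuis (φ : Π x : M, TangentSpace I x →L[ℝ] TangentSpace I x)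
    (X Y : Π x : M, TangentSpace I x) (x : M) : TangentSpace I x :=
  mlieBracket I (fun y ↦ φ y (X y)) (fun y ↦ φ y (Y y)) x + φ x (φ x (mlieBracket I X Y x))
    - φ x (mlieBracket I (fun y ↦ φ y (X y)) Y x) - φ x (mlieBracket I X (fun y ↦ φ y (Y y)) x)

section ExtDeriv

variable [CompleteSpace E] {η : Π x : M, TangentSpace I x →L[ℝ] ℝ}

theorem extDerivOneFun_swap (X Y : Π x : M, TangentSpace I x) (x : M) :
    extDerivOneFun η X Y x = - extDerivOneFun η Y X x := by
  rw [extDerivOneFun, extDerivOneFun, mlieBracket_swap_apply (V := X), map_neg]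
  ring

theorem extDerivOneFun_tensorial_right
    (hη : ContMDiff I (I.prod 𝓘(ℝ, E →L[ℝ] ℝ)) ∞ (fun x ↦ TotalSpace.mk' (E →L[ℝ] ℝ) x (η x)))
    (X : Π x : M, TangentSpace I x) (x : M) :
    TensorialAt I E (fun Y ↦ extDerivOneFun η X Y x) x where
  smul {f Y} hf hY := by
    have h1 : (fun y ↦ η y ((f • Y) y)) = f * fun y ↦ η y (Y y) := by ext y; simp
    simp only [extDerivOneFun, h1, mvfderiv_mul hf (mdifferentiableAt_oneForm hη hY),
      mlieBracket_smul_right hf hY]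
    simp
    ring
  add {Y Y'} hY hY' := by
    have h1 : (fun y ↦ η y ((Y + Y') y)) = (fun y ↦ η y (Y y)) + fun y ↦ η y (Y' y) := by
      ext y; simp
    simp only [extDerivOneFun, h1, mlieBracket_add_right hY hY',
      mvfderiv_add (mdifferentiableAt_oneForm hη hY) (mdifferentiableAt_oneForm hη hY')]
    simp
    ring

theorem extDerivOneFun_tensorial_left
    (hη : ContMDiff I (I.prod 𝓘(ℝ, E →L[ℝ] ℝ)) ∞ (fun x ↦ TotalSpace.mk' (E →L[ℝ] ℝ) x (η x)))
    (Y : Π x : M, TangentSpace I x) (x : M) :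
    TensorialAt I E (fun X ↦ extDerivOneFun η X Y x) x where
  smul {f X} hf hX := by
    have h := (extDerivOneFun_tensorial_right hη Y x).smul hf hX
    simp only [extDerivOneFun_swap _ Y, smul_neg] at h ⊢
    rw [h]
  add {X X'} hX hX' := by
    have h := (extDerivOneFun_tensorial_right hη Y x).add hX hX'
    simp only [extDerivOneFun_swap _ Y] at h ⊢
    rw [h]; ring

end ExtDeriv

variable (I M) in
/-- An almost contact metric structure `(ξ, η, φ, g)` on `M`; the distribution `D` is `ker η`. -/
structure AlmostContactMetricStructure where
  /-- the metric -/
  g : PseudoRiemannianMetric I M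
  /-- the structure vector field -/
  ξ : Π x : M, TangentSpace I x
  /-- the contact form -/
  η : Π x : M, TangentSpace I x →L[ℝ] ℝ
  /-- the structural endomorphism -/
  φ : Π x : M, TangentSpace I x →L[ℝ] TangentSpace I x
  smooth_ξ : IsSmoothVectorField I ξ
  smooth_η : ContMDiff I (I.prod 𝓘(ℝ, E →L[ℝ] ℝ)) ∞
    (fun x ↦ TotalSpace.mk' (E →L[ℝ] ℝ) x (η x))
  smooth_φ : ContMDiff I (I.prod 𝓘(ℝ, E →L[ℝ] E)) ∞
    (fun x ↦ TotalSpace.mk' (E →L[ℝ] E) (E := fun x : M ↦ TangentSpace I x →L[ℝ] TangentSpace I x)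
      x (φ x))
  φ_φ (x : M) (v : TangentSpace I x) : φ x (φ x v) = -v + η x v • ξ x
  η_ξ (x : M) : η x (ξ x) = 1
  g_φ_φ (x : M) (v w : TangentSpace I x) : g.val x (φ x v) (φ x w) = g.val x v w - η x v * η x w

namespace AlmostContactMetricStructure

variable (S : AlmostContactMetricStructure I M)

/-- The fundamental form `Ω(X,Y) = g(X,φY)`. -/
def Ω (x : M) : LinearMap.BilinForm ℝ (TangentSpace I x) :=
  (S.g.bilinForm x).compRight (S.φ x).toLinearMap

theorem Ω_apply (x : M) (v w : TangentSpace I x) : S.Ω x v w = S.g.val x v (S.φ x w) := rfl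

variable [CompleteSpace E] [FiniteDimensional ℝ E]

/-- The `2`-form `ω = dη`, as a bilinear form on each tangent space. -/
def dη (x : M) : TangentSpace I x →L[ℝ] TangentSpace I x →L[ℝ] ℝ :=
  TensorialAt.mkHom₂ (I := I) (F := E) (F' := E) (fun X Y ↦ extDerivOneFun S.η X Y x) x
    (fun Y _ ↦ extDerivOneFun_tensorial_left S.smooth_η Y x)
    (fun X _ ↦ extDerivOneFun_tensorial_right S.smooth_η X x)

theorem dη_apply {X Y : Π x : M, TangentSpace I x} {x : M}
    (hX : MDiffAt (T% X) x) (hY : MDiffAt (T% Y) x) :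
    S.dη x (X x) (Y x) = extDerivOneFun S.η X Y x :=
  TensorialAt.mkHom₂_apply _ _ hX hY

/-- The second structural endomorphism `ψ`, determined by `ω(X,Y) = g(ψX,Y)`. -/
def ψ (x : M) : TangentSpace I x →L[ℝ] TangentSpace I x :=
  LinearMap.toContinuousLinearMap (S.g.sharp x ∘ₗ (S.dη x).toLinearMap)

theorem val_ψ (x : M) (v w : TangentSpace I x) : S.g.val x (S.ψ x v) w = S.dη x v w := by
  simp [ψ, S.g.val_sharp]

/-- `A = φ ∘ ψ`. -/
def A (x : M) : TangentSpace I x →L[ℝ] TangentSpace I x := (S.φ x).comp (S.ψ x)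

/-- `N⁽¹⁾(X,Y) = N_φ(X,Y) + 2 dη(X,Y) ξ`. -/
def normalityTensor (X Y : Π x : M, TangentSpace I x) (x : M) : TangentSpace I x :=
  nijenhuis S.φ X Y x + (2 * S.dη x (X x) (Y x)) • S.ξ x

/-- The structure is normal: `N_φ + 2 dη ⊗ ξ = 0`. -/
def IsNormal : Prop :=
  ∀ X Y : Π x : M, TangentSpace I x, IsSmoothVectorField I X → IsSmoothVectorField I Y →
    ∀ x, S.normalityTensor X Y x = 0

/-- The fundamental form is closed: `dΩ = 0`. -/
def IsFundamentalFormClosed : Prop :=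
  ∀ X Y Z : Π x : M, TangentSpace I x,
    IsSmoothVectorField I X → IsSmoothVectorField I Y → IsSmoothVectorField I Z →
    ∀ x, extDerivTwoFun S.Ω X Y Z x = 0

/-- A quasi-Sasakian structure: a normal almost contact metric structure with closed fundamental
form. -/
def IsQuasiSasakian : Prop := S.IsNormal ∧ S.IsFundamentalFormClosed

/-- `(∇_X φ) Y = ∇_X (φ Y) - φ (∇_X Y)` for the Levi-Civita connection `∇` of `g`. -/
def covDerivφ (X Y : Π x : M, TangentSpace I x) (x : M) : TangentSpace I x :=
  S.g.leviCivita (fun y ↦ S.φ y (Y y)) x (X x) - S.φ x (S.g.leviCivita Y x (X x))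

end AlmostContactMetricStructure

end General

end

section Extension

variable {E : Type*} [NormedAddCommGroup E] [NormedSpace ℝ E] [FiniteDimensional ℝ E]
  {H : Type*} [TopologicalSpace H] {I : ModelWithCorners ℝ E H}
  {M : Type*} [TopologicalSpace M] [ChartedSpace H M] [IsManifold I ∞ M]

/-- Every tangent vector of a Hausdorff manifold is the value of a global smooth vector field. -/
theorem exists_isSmoothVectorField_eq [T2Space M] (x : M) (v : TangentSpace I x) :
    ∃ X : Π x : M, TangentSpace I x, IsSmoothVectorField I X ∧ X x = v := by
  obtain ⟨s, hs, hX⟩ := FiberBundle.exists_contMDiffOn_extend (k := ∞) I E v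
  obtain ⟨t, hts, ht, hxt⟩ := mem_nhds_iff.1 hs
  obtain ⟨f, -, hf⟩ := (SmoothBumpFunction.nhds_basis_tsupport (I := I) x).mem_iff.1
    (ht.mem_nhds hxt)
  refine ⟨fun y ↦ f y • FiberBundle.extend E v y, ?_, by simp⟩
  exact ContMDiffOn.smul_section_of_tsupport f.contMDiff.contMDiffOn ht hf (hX.mono hts)

theorem IsSmoothVectorField.mdifferentiableAt {X : Π x : M, TangentSpace I x}
    (hX : IsSmoothVectorField I X) (x : M) : MDiffAt (T% X) x :=
  ContMDiff.mdifferentiable hX (by simp) x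

end Extension

namespace AlmostContactMetricStructure

variable {E : Type*} [NormedAddCommGroup E] [NormedSpace ℝ E]
  {H : Type*} [TopologicalSpace H] {I : ModelWithCorners ℝ E H}
  {M : Type*} [TopologicalSpace M] [ChartedSpace H M] [IsManifold I ∞ M]
  (S : AlmostContactMetricStructure I M)

theorem ξ_ne_zero (x : M) : S.ξ x ≠ 0 := fun h ↦ by simpa [h] using S.η_ξ x

theorem η_φ (x : M) (v : TangentSpace I x) : S.η x (S.φ x v) = 0 := by
  have h1 := S.φ_φ x (S.φ x v)
  have h2 := congr(S.φ x $(S.φ_φ x v))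
  have h3 := S.φ_φ x (S.ξ x)
  rw [S.η_ξ, one_smul, neg_add_cancel] at h3
  have h4 := S.φ_φ x (S.φ x (S.ξ x))
  rw [h3, map_zero, eq_comm, neg_add_eq_zero] at h4
  have h5 : S.φ x (S.ξ x) = 0 := by
    obtain ⟨c, hc⟩ : ∃ c : ℝ, S.φ x (S.ξ x) = c • S.ξ x := ⟨_, h4⟩
    rw [hc, map_smul, hc, smul_smul] at h3
    have := (smul_eq_zero.1 h3).resolve_right (S.ξ_ne_zero x)
    rw [hc, mul_self_eq_zero.1 this, zero_smul]
  rw [map_add, map_neg, map_smul, h5, smul_zero, add_zero, h1, add_eq_left] at h2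
  exact (smul_eq_zero.1 h2).resolve_right (S.ξ_ne_zero x)

theorem φ_ξ (x : M) : S.φ x (S.ξ x) = 0 := by
  have h := S.φ_φ x (S.φ x (S.ξ x))
  rw [S.φ_φ x (S.ξ x), S.η_ξ, S.η_φ] at h
  simpa using h.symm

theorem val_ξ_right (x : M) (v : TangentSpace I x) : S.g.val x v (S.ξ x) = S.η x v := by
  have h := S.g_φ_φ x v (S.ξ x)
  rw [S.φ_ξ, S.η_ξ, map_zero] at h
  linarith

theorem val_ξ_left (x : M) (v : TangentSpace I x) : S.g.val x (S.ξ x) v = S.η x v := by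
  rw [S.g.symm, S.val_ξ_right]

theorem val_φ_left (x : M) (v w : TangentSpace I x) :
    S.g.val x (S.φ x v) w = - S.g.val x v (S.φ x w) := by
  have h := S.g_φ_φ x (S.φ x v) w
  rw [S.φ_φ, S.η_φ] at h
  simp only [map_add, map_neg, map_smul, add_apply, neg_apply, smul_apply,
    S.val_ξ_left, S.η_φ, smul_zero] at h
  linarith

theorem mdifferentiableAt_φ {X : Π x : M, TangentSpace I x} {x : M} (hX : MDiffAt (T% X) x) :
    MDiffAt (T% (fun y ↦ S.φ y (X y))) x :=
  MDifferentiableAt.clm_bundle_apply (F₁ := E) (F₂ := E)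
    (S.smooth_φ.mdifferentiable (by simp) x) hX

theorem mdifferentiableAt_ξ (x : M) : MDiffAt (T% S.ξ) x :=
  ContMDiff.mdifferentiable S.smooth_ξ (by simp) x

variable [CompleteSpace E] [FiniteDimensional ℝ E]

theorem covDerivφ_tensorial_left (Y : Π x : M, TangentSpace I x) (x : M) :
    TensorialAt I E (fun X ↦ S.covDerivφ X Y x) x where
  smul _ _ := by simp [covDerivφ, smul_sub]
  add _ _ := by simp only [covDerivφ, Pi.add_apply, map_add]; abel

theorem covDerivφ_tensorial_right (X : Π x : M, TangentSpace I x) (x : M) :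
    TensorialAt I E (fun Y ↦ S.covDerivφ X Y x) x where
  smul {f Y} hf hY := by
    have h : (fun y ↦ S.φ y ((f • Y) y)) = f • fun y ↦ S.φ y (Y y) := by ext1 y; simp
    rw [covDerivφ, h, S.g.leviCivita.isCovariantDerivativeOnUniv.leibniz hY hf,
      S.g.leviCivita.isCovariantDerivativeOnUniv.leibniz (S.mdifferentiableAt_φ hY) hf]
    simp [covDerivφ, smul_sub]
  add {Y Y'} hY hY' := by
    have h : (fun y ↦ S.φ y ((Y + Y') y)) = (fun y ↦ S.φ y (Y y)) + fun y ↦ S.φ y (Y' y) := by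
      ext1 y; simp
    rw [covDerivφ, h, S.g.leviCivita.isCovariantDerivativeOnUniv.add hY hY',
      S.g.leviCivita.isCovariantDerivativeOnUniv.add (S.mdifferentiableAt_φ hY)
        (S.mdifferentiableAt_φ hY')]
    simp only [covDerivφ, add_apply, map_add]
    abel

/-- The tensor `(u, v) ↦ (∇_u φ) v`. -/
noncomputable def nablaφ (x : M) : TangentSpace I x →L[ℝ] TangentSpace I x →L[ℝ] TangentSpace I x :=
  TensorialAt.mkHom₂ (I := I) (F := E) (F' := E) (fun X Y ↦ S.covDerivφ X Y x) x
    (fun Y _ ↦ S.covDerivφ_tensorial_left Y x) (fun X _ ↦ S.covDerivφ_tensorial_right X x)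

theorem nablaφ_apply {X Y : Π x : M, TangentSpace I x} {x : M}
    (hX : MDiffAt (T% X) x) (hY : MDiffAt (T% Y) x) :
    S.nablaφ x (X x) (Y x) = S.covDerivφ X Y x :=
  TensorialAt.mkHom₂_apply _ _ hX hY

theorem leviCivita_φ {X Y : Π x : M, TangentSpace I x} {x : M}
    (hX : MDiffAt (T% X) x) (hY : MDiffAt (T% Y) x) :
    S.g.leviCivita (fun y ↦ S.φ y (Y y)) x (X x) =
      S.nablaφ x (X x) (Y x) + S.φ x (S.g.leviCivita Y x (X x)) := by
  rw [S.nablaφ_apply hX hY, covDerivφ, sub_add_cancel]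

theorem mlieBracket_eq_leviCivita {X Y : Π x : M, TangentSpace I x} {x : M}
    (hX : MDiffAt (T% X) x) (hY : MDiffAt (T% Y) x) :
    mlieBracket I X Y x = S.g.leviCivita Y x (X x) - S.g.leviCivita X x (Y x) :=
  ((CovariantDerivative.torsion_eq_zero_iff _).1 S.g.leviCivita_torsion hX hY).symm

/-- The form `(u, v, w) ↦ g((∇_u φ) v, w)` is skew in the last two arguments. -/
theorem val_nablaφ_skew (x : M) (u v w : TangentSpace I x) :
    S.g.val x (S.nablaφ x u v) w = - S.g.val x (S.nablaφ x u w) v := by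
  obtain ⟨X, hX, rfl⟩ : ∃ X : Π x : M, TangentSpace I x, MDiffAt (T% X) x ∧ X x = u :=
    ⟨_, FiberBundle.mdifferentiableAt_extend I E u, by simp⟩
  obtain ⟨Y, hY, rfl⟩ : ∃ X : Π x : M, TangentSpace I x, MDiffAt (T% X) x ∧ X x = v :=
    ⟨_, FiberBundle.mdifferentiableAt_extend I E v, by simp⟩
  obtain ⟨Z, hZ, rfl⟩ : ∃ X : Π x : M, TangentSpace I x, MDiffAt (T% X) x ∧ X x = w :=
    ⟨_, FiberBundle.mdifferentiableAt_extend I E w, by simp⟩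
  have h1 := S.g.leviCivita_metric hX (S.mdifferentiableAt_φ hY) hZ
  have h2 := S.g.leviCivita_metric hX hY (S.mdifferentiableAt_φ hZ)
  have e : S.g.pair (fun y ↦ S.φ y (Y y)) Z = - S.g.pair Y (fun y ↦ S.φ y (Z y)) := by
    ext y; exact S.val_φ_left _ _ _
  rw [e, mvfderiv_neg, neg_apply, h2, S.leviCivita_φ hX hY, S.leviCivita_φ hX hZ] at h1
  simp only [map_add, add_apply, S.val_φ_left] at h1
  rw [S.g.symm x (S.nablaφ x (X x) (Z x))]
  linarith

theorem η_leviCivita_ξ (x : M) (u : TangentSpace I x) :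
    S.η x (S.g.leviCivita S.ξ x u) = 0 := by
  obtain ⟨X, hX, rfl⟩ : ∃ X : Π x : M, TangentSpace I x, MDiffAt (T% X) x ∧ X x = u :=
    ⟨_, FiberBundle.mdifferentiableAt_extend I E u, by simp⟩
  have h := S.g.leviCivita_metric hX (S.mdifferentiableAt_ξ x) (S.mdifferentiableAt_ξ x)
  have e : S.g.pair S.ξ S.ξ = fun _ ↦ (1 : ℝ) := by
    ext y; simp [PseudoRiemannianMetric.pair, S.val_ξ_left, S.η_ξ]
  rw [e, mvfderiv_const, S.val_ξ_left, S.val_ξ_right] at h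
  simp at h
  linarith

theorem mvfderiv_η {X Y : Π x : M, TangentSpace I x} {x : M}
    (hX : MDiffAt (T% X) x) (hY : MDiffAt (T% Y) x) :
    mvfderiv I (fun y ↦ S.η y (Y y)) x (X x) =
      S.η x (S.g.leviCivita Y x (X x)) + S.g.val x (S.g.leviCivita S.ξ x (X x)) (Y x) := by
  have h := S.g.leviCivita_metric hX hY (S.mdifferentiableAt_ξ x)
  have e : S.g.pair Y S.ξ = fun y ↦ S.η y (Y y) := by
    ext y; exact S.val_ξ_right _ _
  rw [e, S.val_ξ_right, S.g.symm x (Y x)] at h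
  exact h

theorem two_mul_dη (x : M) (u v : TangentSpace I x) :
    2 * S.dη x u v = S.g.val x (S.g.leviCivita S.ξ x u) v
      - S.g.val x (S.g.leviCivita S.ξ x v) u := by
  obtain ⟨X, hX, rfl⟩ : ∃ X : Π x : M, TangentSpace I x, MDiffAt (T% X) x ∧ X x = u :=
    ⟨_, FiberBundle.mdifferentiableAt_extend I E u, by simp⟩
  obtain ⟨Y, hY, rfl⟩ : ∃ X : Π x : M, TangentSpace I x, MDiffAt (T% X) x ∧ X x = v :=
    ⟨_, FiberBundle.mdifferentiableAt_extend I E v, by simp⟩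
  rw [S.dη_apply hX hY, extDerivOneFun, S.mvfderiv_η hX hY, S.mvfderiv_η hY hX,
    S.mlieBracket_eq_leviCivita hX hY, map_sub]
  ring

theorem dη_swap (x : M) (u v : TangentSpace I x) : S.dη x u v = - S.dη x v u := by
  have h1 := S.two_mul_dη x u v
  have h2 := S.two_mul_dη x v u
  linarith

/-- The derivative of the identity `φ² = -1 + η ⊗ ξ`. -/
theorem nablaφ_φ (x : M) (u v : TangentSpace I x) :
    S.nablaφ x u (S.φ x v) + S.φ x (S.nablaφ x u v) =
      S.g.val x (S.g.leviCivita S.ξ x u) v • S.ξ x + S.η x v • S.g.leviCivita S.ξ x u := by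
  obtain ⟨X, hX, rfl⟩ : ∃ X : Π x : M, TangentSpace I x, MDiffAt (T% X) x ∧ X x = u :=
    ⟨_, FiberBundle.mdifferentiableAt_extend I E u, by simp⟩
  obtain ⟨Y, hY, rfl⟩ : ∃ X : Π x : M, TangentSpace I x, MDiffAt (T% X) x ∧ X x = v :=
    ⟨_, FiberBundle.mdifferentiableAt_extend I E v, by simp⟩
  have h := S.leviCivita_φ hX (S.mdifferentiableAt_φ hY)
  rw [S.leviCivita_φ hX hY] at h
  have e : (fun y ↦ S.φ y (S.φ y (Y y))) =
      (fun _ : M ↦ (-1 : ℝ)) • Y + (fun y : M ↦ S.η y (Y y)) • S.ξ := by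
    ext1 y; simp [S.φ_φ]
  have hη := mdifferentiableAt_oneForm S.smooth_η hY
  have hξ := S.mdifferentiableAt_ξ x
  have hc : MDiffAt (fun _ : M ↦ (-1 : ℝ)) x := mdifferentiableAt_const
  rw [e, S.g.leviCivita.isCovariantDerivativeOnUniv.add (hc.smul_section hY) (hη.smul_section hξ),
    S.g.leviCivita.isCovariantDerivativeOnUniv.leibniz hξ hη,
    S.g.leviCivita.isCovariantDerivativeOnUniv.leibniz hY hc, mvfderiv_const] at h
  simp only [add_apply, smul_apply, ContinuousLinearMap.smulRight_apply, S.mvfderiv_η hX hY,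
    map_add, S.φ_φ, zero_apply, zero_smul, add_zero] at h
  linear_combination (norm := module) -h

theorem nijenhuis_eq {X Y : Π x : M, TangentSpace I x} {x : M}
    (hX : MDiffAt (T% X) x) (hY : MDiffAt (T% Y) x) :
    nijenhuis S.φ X Y x = S.nablaφ x (S.φ x (X x)) (Y x) - S.nablaφ x (S.φ x (Y x)) (X x)
      - S.φ x (S.nablaφ x (X x) (Y x)) + S.φ x (S.nablaφ x (Y x) (X x)) := by
  have hX' := S.mdifferentiableAt_φ hX
  have hY' := S.mdifferentiableAt_φ hY
  rw [nijenhuis, S.mlieBracket_eq_leviCivita hX hY, S.mlieBracket_eq_leviCivita hX' hY,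
    S.mlieBracket_eq_leviCivita hX hY', S.mlieBracket_eq_leviCivita hX' hY',
    S.leviCivita_φ hX' hY, S.leviCivita_φ hY' hX, S.leviCivita_φ hX hY, S.leviCivita_φ hY hX]
  simp only [map_add, map_sub]
  abel

theorem mvfderiv_Ω {X Y Z : Π x : M, TangentSpace I x} {x : M}
    (hX : MDiffAt (T% X) x) (hY : MDiffAt (T% Y) x) (hZ : MDiffAt (T% Z) x) :
    mvfderiv I (fun y ↦ S.Ω y (Y y) (Z y)) x (X x) =
      S.g.val x (S.nablaφ x (X x) (Z x)) (Y x) + S.Ω x (S.g.leviCivita Y x (X x)) (Z x)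
        + S.Ω x (Y x) (S.g.leviCivita Z x (X x)) := by
  have h := S.g.leviCivita_metric hX hY (S.mdifferentiableAt_φ hZ)
  rw [S.leviCivita_φ hX hZ, map_add, S.g.symm x (Y x) (S.nablaφ x _ _)] at h
  refine h.trans ?_
  simp only [Ω_apply]
  ring

theorem Ω_swap (x : M) (u v : TangentSpace I x) : S.Ω x u v = - S.Ω x v u := by
  rw [Ω_apply, Ω_apply, S.g.symm, S.val_φ_left]

theorem extDerivTwoFun_Ω {X Y Z : Π x : M, TangentSpace I x} {x : M}
    (hX : MDiffAt (T% X) x) (hY : MDiffAt (T% Y) x) (hZ : MDiffAt (T% Z) x) :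
    3 * extDerivTwoFun S.Ω X Y Z x = - (S.g.val x (S.nablaφ x (X x) (Y x)) (Z x)
      + S.g.val x (S.nablaφ x (Y x) (Z x)) (X x) + S.g.val x (S.nablaφ x (Z x) (X x)) (Y x)) := by
  rw [extDerivTwoFun, S.mvfderiv_Ω hX hY hZ, S.mvfderiv_Ω hY hZ hX, S.mvfderiv_Ω hZ hX hY,
    S.mlieBracket_eq_leviCivita hX hY, S.mlieBracket_eq_leviCivita hY hZ,
    S.mlieBracket_eq_leviCivita hZ hX]
  simp only [map_sub, LinearMap.sub_apply]
  rw [S.Ω_swap x (Y x), S.Ω_swap x (Z x), S.Ω_swap x (X x), S.val_nablaφ_skew x (X x) (Z x),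
    S.val_nablaφ_skew x (Y x) (X x), S.val_nablaφ_skew x (Z x) (Y x)]
  ring

theorem val_A (x : M) (u v : TangentSpace I x) :
    S.g.val x (S.A x u) v = - S.dη x u (S.φ x v) := by
  rw [A, ContinuousLinearMap.comp_apply, S.val_φ_left, S.val_ψ]

theorem val_nablaφ_ξ (x : M) (u v : TangentSpace I x) :
    S.g.val x (S.nablaφ x u v) (S.ξ x) = - S.g.val x (S.g.leviCivita S.ξ x u) (S.φ x v) := by
  have h := S.nablaφ_φ x u (S.ξ x)
  rw [S.φ_ξ, map_zero, zero_add, S.val_ξ_right, S.η_leviCivita_ξ, S.η_ξ, zero_smul, zero_add,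
    one_smul] at h
  have h1 := S.g_φ_φ x (S.nablaφ x u (S.ξ x)) v
  have h2 := S.val_nablaφ_skew x u (S.ξ x) (S.ξ x)
  rw [h, ← S.val_ξ_right] at h1
  rw [S.val_nablaφ_skew, h1]
  linear_combination -(S.η x v / 2) * h2

/-- The expression of `∇φ` for a normal structure with closed fundamental form. -/
theorem nablaφ_eq_of_normal_of_closed {x : M}
    (hN : ∀ u v, S.nablaφ x (S.φ x u) v - S.nablaφ x (S.φ x v) u - S.φ x (S.nablaφ x u v)
      + S.φ x (S.nablaφ x v u) + (2 * S.dη x u v) • S.ξ x = 0)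
    (hC : ∀ u v w, S.g.val x (S.nablaφ x u v) w + S.g.val x (S.nablaφ x v w) u
      + S.g.val x (S.nablaφ x w u) v = 0) (u v : TangentSpace I x) :
    S.nablaφ x u v = S.g.val x (S.A x v) u • S.ξ x - S.η x v • S.A x u := by
  have hinv (u v) : S.dη x (S.φ x u) (S.φ x v) = S.dη x u v := by
    have h := congr(S.η x $(hN u v))
    have h1 := S.two_mul_dη x (S.φ x u) (S.φ x v)
    simp only [map_add, map_sub, map_smul, S.η_φ, S.η_ξ, map_zero,
      ← S.val_ξ_right x (S.nablaφ x _ _), S.val_nablaφ_ξ, smul_eq_mul] at h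
    linarith
  have hcomm (u v) : S.dη x (S.φ x u) v = - S.dη x u (S.φ x v) := by
    have hξ : S.dη x (S.ξ x) (S.φ x v) = 0 := by
      have := hinv (S.ξ x) (S.φ x v)
      simpa [S.φ_ξ] using this.symm
    rw [← hinv (S.φ x u) v, S.φ_φ]
    simp [hξ]
  have hb (u v w) : S.g.val x (S.nablaφ x u (S.φ x v)) w - S.g.val x (S.nablaφ x u v) (S.φ x w) =
      S.g.val x (S.g.leviCivita S.ξ x u) v * S.η x w
        + S.η x v * S.g.val x (S.g.leviCivita S.ξ x u) w := by
    have h := congr(S.g.val x $(S.nablaφ_φ x u v) w)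
    simp only [map_add, map_smul, add_apply, smul_apply, S.val_φ_left, S.val_ξ_left,
      smul_eq_mul] at h
    linarith
  refine S.g.ext_val fun w ↦ ?_
  have h1 := congr(S.g.val x $(hN v w) (S.φ x u))
  simp only [map_add, map_sub, map_smul, add_apply, sub_apply, smul_apply, S.val_φ_left,
    S.val_ξ_left, S.η_φ, S.φ_φ, smul_eq_mul, map_zero, map_neg, S.val_nablaφ_ξ, zero_apply] at h1
  have h2 := hb u v (S.φ x w)
  simp only [map_add, map_smul, S.η_φ, S.φ_φ, smul_eq_mul, map_neg, S.val_nablaφ_ξ] at h2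
  have h3 := hb (S.φ x v) w u
  have h4 := hb (S.φ x w) v u
  have h5 := hC u v w
  have h6 := hC u (S.φ x v) (S.φ x w)
  have d1 := S.two_mul_dη x u (S.φ x v)
  have d2 := S.two_mul_dη x u (S.φ x w)
  have d3 := S.two_mul_dη x (S.φ x v) w
  have d4 := S.two_mul_dη x v (S.φ x w)
  have k1 := S.val_nablaφ_skew x w v u
  have k2 := S.val_nablaφ_skew x (S.φ x w) (S.φ x v) u
  simp only [map_sub, map_smul, sub_apply, smul_apply, S.val_ξ_left, S.val_A, smul_eq_mul]
  rw [S.dη_swap x v (S.φ x u), hcomm]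
  have k3 := hcomm v w
  linear_combination (h1 + h3 - h4 + k2 - h6 + h2 + h5 - k1 + S.η x w * d1 - S.η x v * d2
    - S.η x u * (d3 + d4) + 2 * S.η x u * k3) / 2

/-- If `∇φ` has the quasi-Sasakian form, then `A` is symmetric and `ψξ = 0`; hence the structure
is normal and its fundamental form is closed. -/
theorem normal_and_closed_of_nablaφ_eq {x : M}
    (hT : ∀ u v, S.nablaφ x u v = S.g.val x (S.A x v) u • S.ξ x - S.η x v • S.A x u) :
    (∀ u v, S.nablaφ x (S.φ x u) v - S.nablaφ x (S.φ x v) u - S.φ x (S.nablaφ x u v)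
      + S.φ x (S.nablaφ x v u) + (2 * S.dη x u v) • S.ξ x = 0) ∧
    ∀ u v w, S.g.val x (S.nablaφ x u v) w + S.g.val x (S.nablaφ x v w) u
      + S.g.val x (S.nablaφ x w u) v = 0 := by
  have hF (u v w) : S.g.val x (S.nablaφ x u v) w =
      - S.dη x v (S.φ x u) * S.η x w + S.η x v * S.dη x u (S.φ x w) := by
    rw [hT]
    simp only [map_sub, map_smul, sub_apply, smul_apply, S.val_ξ_left, S.val_A, smul_eq_mul]
    ring
  have hξφ (u) : S.dη x (S.ξ x) (S.φ x u) = 0 := by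
    have h := S.val_nablaφ_skew x u (S.ξ x) (S.ξ x)
    simp only [hF, S.η_ξ, S.φ_ξ, map_zero] at h
    linarith
  have hξ (u) : S.dη x (S.ξ x) u = 0 := by
    have h := hξφ (S.φ x u)
    have h0 := S.dη_swap x (S.ξ x) (S.ξ x)
    simp only [S.φ_φ, map_add, map_neg, map_smul, smul_eq_mul] at h
    linear_combination -h + S.η x u / 2 * h0
  have hsymm (u v) : S.dη x u (S.φ x v) = S.dη x v (S.φ x u) := by
    have h := S.val_nablaφ_skew x u v (S.ξ x)
    simp only [hF, S.η_ξ, S.φ_ξ, map_zero, hξφ] at h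
    linarith
  refine ⟨fun u v ↦ S.g.ext_val fun w ↦ ?_, fun u v w ↦ ?_⟩
  · have h1 := hsymm u (S.φ x v)
    have h2 := hsymm v (S.φ x u)
    have h3 := S.dη_swap x u v
    have h4 := S.dη_swap x u (S.ξ x)
    have h5 := S.dη_swap x v (S.ξ x)
    simp only [map_add, map_sub, map_smul, add_apply, sub_apply, smul_apply, S.val_φ_left, hF,
      S.val_ξ_left, S.η_φ, smul_eq_mul, map_zero, zero_apply, S.φ_φ, map_neg, hξ] at h1 h2 h4 h5 ⊢
    have h8 := hsymm (S.φ x u) w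
    have h9 := hsymm (S.φ x v) w
    simp only [S.φ_φ, map_add, map_neg, map_smul, smul_eq_mul, S.dη_swap x w (S.ξ x), hξ] at h8 h9
    have h10 := S.dη_swap x u w
    have h11 := S.dη_swap x v w
    simp only [h4, h5, h8, h9, h10, h11]
    linear_combination S.η x w * h3
  · simp only [hF, hsymm v u, hsymm w v]
    ring

theorem isQuasiSasakian_iff [T2Space M] :
    S.IsQuasiSasakian ↔ ∀ X Y : Π x : M, TangentSpace I x,
      IsSmoothVectorField I X → IsSmoothVectorField I Y → ∀ x, S.covDerivφ X Y x =
        S.g.val x (S.A x (Y x)) (X x) • S.ξ x - S.η x (Y x) • S.A x (X x) := by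
  constructor
  · rintro ⟨hN, hC⟩ X Y hX hY x
    rw [← S.nablaφ_apply (hX.mdifferentiableAt x) (hY.mdifferentiableAt x)]
    refine S.nablaφ_eq_of_normal_of_closed (fun u v ↦ ?_) (fun u v w ↦ ?_) _ _
    · obtain ⟨U, hU, rfl⟩ := exists_isSmoothVectorField_eq x u
      obtain ⟨V, hV, rfl⟩ := exists_isSmoothVectorField_eq x v
      rw [← S.nijenhuis_eq (hU.mdifferentiableAt x) (hV.mdifferentiableAt x)]
      exact hN U V hU hV x
    · obtain ⟨U, hU, rfl⟩ := exists_isSmoothVectorField_eq x u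
      obtain ⟨V, hV, rfl⟩ := exists_isSmoothVectorField_eq x v
      obtain ⟨W, hW, rfl⟩ := exists_isSmoothVectorField_eq x w
      have h := S.extDerivTwoFun_Ω (hU.mdifferentiableAt x) (hV.mdifferentiableAt x)
        (hW.mdifferentiableAt x)
      rw [hC U V W hU hV hW x] at h
      linarith
  · intro h
    have hT (x : M) (u v : TangentSpace I x) :
        S.nablaφ x u v = S.g.val x (S.A x v) u • S.ξ x - S.η x v • S.A x u := by
      obtain ⟨U, hU, rfl⟩ := exists_isSmoothVectorField_eq x u
      obtain ⟨V, hV, rfl⟩ := exists_isSmoothVectorField_eq x v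
      rw [S.nablaφ_apply (hU.mdifferentiableAt x) (hV.mdifferentiableAt x), h U V hU hV]
    refine ⟨fun X Y hX hY x ↦ ?_, fun X Y Z hX hY hZ x ↦ ?_⟩
    · rw [normalityTensor, S.nijenhuis_eq (hX.mdifferentiableAt x) (hY.mdifferentiableAt x)]
      exact (S.normal_and_closed_of_nablaφ_eq (hT x)).1 _ _
    · have h1 := S.extDerivTwoFun_Ω (hX.mdifferentiableAt x) (hY.mdifferentiableAt x)
        (hZ.mdifferentiableAt x)
      rw [(S.normal_and_closed_of_nablaφ_eq (hT x)).2] at h1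
      linarith

end AlmostContactMetricStructure

theorem proposition4 (m : ℕ) (M : Type*) [TopologicalSpace M] [T2Space M]
    [SecondCountableTopology M] [ChartedSpace (EuclideanSpace ℝ (Fin (2 * m + 1))) M]
    [IsManifold (𝓡 (2 * m + 1)) ∞ M]
    (S : AlmostContactMetricStructure (𝓡 (2 * m + 1)) M) :
    S.IsQuasiSasakian ↔
      ∀ X Y : Π x : M, TangentSpace (𝓡 (2 * m + 1)) x,
        IsSmoothVectorField (𝓡 (2 * m + 1)) X → IsSmoothVectorField (𝓡 (2 * m + 1)) Y →
          ∀ x : M, S.covDerivφ X Y x =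
            S.g.val x (S.A x (Y x)) (X x) • S.ξ x - S.η x (Y x) • S.A x (X x) := by
  exact S.isQuasiSasakian_iff
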